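/- Let $d\ge 1$ be an integer, let $H,K$ be complex Hilbert spaces, and let $A=(A_1,\dots,A_d)\in\mathcal B(H)^d$ and $B=(B_1,\dots,B_d)\in\mathcal B(K)^d$ be $d$-tuples of bounded operators. Write $M_n=M_n(\mathbb C)$, $L_A(X)=I\otimes I_n-\sum_{j=1}^d A_j\otimes X_j$ for $X=(X_1,\dots,X_d)\in M_n^d$, and $$\mathcal D_A(n)=\{X\in M_n^d:\operatorname{Re}L_A(X)\ge 0\},\qquad \mathcal D_A=\bigcup_n\mathcal D_A(n),$$ where $\operatorname{Re}T=\tfrac12(T+T^*)$; inclusion and equality of such sets mean inclusion and equality at every level $n$. The set $\mathcal D_A$ is bounded if there is $R$ such that $\|X_i\|\le R$ (operator norm) for all $n$, all $X\in\mathcal D_A(n)$ and all $i$. Let $S_A=\operatorname{span}\{I,A_i,A_i^*:1\le i\le d\}$ be the operator system generated by $A$, and let $S_B$ be that generated by $B$. Identify $M_n(S_A)$ with a subspace of $\mathcal B(H^n)$, with the inherited positivity and norm, and likewise for $M_n(S_B)$. A linear map $\phi:S_A\to S_B$ is $n$-positive if its entrywise amplification $M_n(S_A)\to M_n(S_B)$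 maps positive elements to positive elements; it is UCP if it is unital and $n$-positive for all $n$; it is completely isometric if all its amplifications are isometric. Suppose that $\mathcal D_A$ is bounded. Then: 1. For a given $n\in\mathbb N$, if there exists a unital $n$-positive linear map $\phi:S_A\to S_B$ with $\phi(A_i)=B_i$ for all $i$, then $\mathcal D_A(n)\subseteq\mathcal D_B(n)$. 2. There exists a UCP map $\phi:S_A\to S_B$ with $\phi(A_i)=B_i$ for all $i$ if and only if $\mathcal D_A\subseteq\mathcal D_B$. 3. There exists a unital completely isometric linear map $\phi:S_A\to S_B$ with $\phi(A_i)=B_i$ for all $i$ if and only if $\mathcal D_A=\mathcal D_B$. The same holds in the self-adjoint case: if all $A_i$ and $B_i$ are self-adjoint, put $\mathcal D_A^{sa}(n)=\{X\in M_n^d: X_j=X_j^*\text{ for all }j,\ L_A(X)\ge 0\}$ and $\mathcal D_A^{sa}=\bigcup_n\mathcal D_A^{sa}(n)$, and suppose that $\mathcal D_A^{sa}$ is bounded. Then statements 1, 2 and 3 hold with $\mathcal D_A,\mathcal D_B$ replaced by $\mathcal D_A^{sa},\mathcal D_B^{sa}$ throughout. -/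

import Mathlib

/-- A free set in `d` free dimensions: for every `n`, a set of `d`-tuples of complex
`n × n` matrices. (The level `n = 0` is a one-point space and carries no information.) -/
abbrev FreeSet (d : ℕ) : Type :=
  ∀ n : ℕ, Set (Fin d → Matrix (Fin n) (Fin n) ℂ)

/-- A free set is bounded if one constant bounds the operator norms of all the coordinates
of all its elements, at all levels simultaneously. -/
def FreeSet.IsBounded {d : ℕ} (S : FreeSet d) : Prop :=
  ∃ R : ℝ, ∀ n : ℕ, ∀ X ∈ S n, ∀ i : Fin d, ‖Matrix.toEuclideanCLM (𝕜 := ℂ) (X i)‖ ≤ R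

section Operators

variable {H : Type*} [NormedAddCommGroup H] [InnerProductSpace ℂ H]

/-- The operator on the Hilbert space `Hⁿ = H ⊗ ℂⁿ` given by an `n × n` matrix of bounded
operators on `H`; this is the standard identification of `Mₙ(B(H))` with `B(Hⁿ)`. -/
noncomputable def blockOp {n : ℕ} (M : Matrix (Fin n) (Fin n) (H →L[ℂ] H)) :
    PiLp 2 (fun _ : Fin n => H) →L[ℂ] PiLp 2 (fun _ : Fin n => H) :=
  ((PiLp.continuousLinearEquiv 2 ℂ (fun _ : Fin n => H)).symm :
      (Fin n → H) →L[ℂ] PiLp 2 (fun _ : Fin n => H)) ∘L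
    ContinuousLinearMap.pi (fun i => ∑ j, M i j ∘L PiLp.proj 2 (fun _ : Fin n => H) j)

theorem blockOp_apply {n : ℕ} (M : Matrix (Fin n) (Fin n) (H →L[ℂ] H))
    (x : PiLp 2 (fun _ : Fin n => H)) (i : Fin n) :
    blockOp M x i = ∑ j, M i j (x j) := by
  simp [blockOp]

/-- The monic linear pencil `L_A(X) = I ⊗ Iₙ - ∑ₖ Aₖ ⊗ Xₖ`, as an operator on `H ⊗ ℂⁿ = Hⁿ`.
The `(i, j)` block of `A ⊗ X` is `X i j • A`. -/
noncomputable def linearPencil {d n : ℕ} (A : Fin d → H →L[ℂ] H)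
    (X : Fin d → Matrix (Fin n) (Fin n) ℂ) :
    PiLp 2 (fun _ : Fin n => H) →L[ℂ] PiLp 2 (fun _ : Fin n => H) :=
  1 - ∑ k, blockOp (Matrix.of fun i j => X k i j • A k)

/-- The self-adjoint free spectrahedron: tuples of self-adjoint matrices `X` with
`L_A(X) ≥ 0`. It is used for tuples `A` of self-adjoint operators. -/
def saFreeSpectrahedron {d : ℕ} (A : Fin d → H →L[ℂ] H) : FreeSet d :=
  fun _ => {X | (∀ k, (X k).IsHermitian) ∧ (linearPencil A X).IsPositive}

variable [CompleteSpace H]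

/-- The free spectrahedron: tuples of matrices `X` with `Re L_A(X) ≥ 0`, where
`Re T = (T + T*) / 2`. -/
def freeSpectrahedron {d : ℕ} (A : Fin d → H →L[ℂ] H) : FreeSet d :=
  fun n => {X | ((realPart (linearPencil A X) : selfAdjoint _) :
    PiLp 2 (fun _ : Fin n => H) →L[ℂ] PiLp 2 (fun _ : Fin n => H)).IsPositive}

/-- The operator system `S_A` generated by a tuple `A`: the linear span of the identity, the
`Aᵢ` and their adjoints. -/
def operatorSystem {d : ℕ} (A : Fin d → H →L[ℂ] H) : Submodule ℂ (H →L[ℂ] H) :=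
  Submodule.span ℂ ({1} ∪ Set.range A ∪ Set.range fun i => ContinuousLinearMap.adjoint (A i))

theorem one_mem_operatorSystem {d : ℕ} (A : Fin d → H →L[ℂ] H) :
    (1 : H →L[ℂ] H) ∈ operatorSystem A :=
  Submodule.subset_span (Or.inl (Or.inl rfl))

theorem mem_operatorSystem {d : ℕ} (A : Fin d → H →L[ℂ] H) (i : Fin d) :
    A i ∈ operatorSystem A :=
  Submodule.subset_span (Or.inl (Or.inr ⟨i, rfl⟩))

end Operators

section Maps

variable {H K : Type*} [NormedAddCommGroup H] [InnerProductSpace ℂ H]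
  [NormedAddCommGroup K] [InnerProductSpace ℂ K]

/-- A linear map `φ` between spaces of operators is `n`-positive if applying it to every entry
sends positive elements of `Mₙ(S)` to positive elements of `Mₙ(T)`, where `Mₙ(S)` is regarded
inside `B(Hⁿ)` and `Mₙ(T)` inside `B(Kⁿ)`. -/
def IsNPositive (n : ℕ) {S : Submodule ℂ (H →L[ℂ] H)} {T : Submodule ℂ (K →L[ℂ] K)}
    (φ : S →ₗ[ℂ] T) : Prop :=
  ∀ M : Matrix (Fin n) (Fin n) S,
    (blockOp (M.map fun s => (s : H →L[ℂ] H))).IsPositive →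
      (blockOp (M.map fun s => (φ s : K →L[ℂ] K))).IsPositive

/-- A linear map is completely positive if it is `n`-positive for all `n`. -/
def IsCompletelyPositive {S : Submodule ℂ (H →L[ℂ] H)} {T : Submodule ℂ (K →L[ℂ] K)}
    (φ : S →ₗ[ℂ] T) : Prop :=
  ∀ n : ℕ, IsNPositive n φ

/-- A linear map is completely isometric if all its entrywise amplifications `Mₙ(S) → Mₙ(T)`
preserve the operator norm. -/
def IsCompletelyIsometric {S : Submodule ℂ (H →L[ℂ] H)} {T : Submodule ℂ (K →L[ℂ] K)}
    (φ : S →ₗ[ℂ] T) : Prop :=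
  ∀ n : ℕ, ∀ M : Matrix (Fin n) (Fin n) S,
    ‖blockOp (M.map fun s => (φ s : K →L[ℂ] K))‖ =
      ‖blockOp (M.map fun s => (s : H →L[ℂ] H))‖

variable [CompleteSpace H] [CompleteSpace K]

/-- The linear map `φ : S_A → S_B` is unital and maps `Aᵢ` to `Bᵢ` for all `i`. -/
def IsUnitalInterpolating {d : ℕ} (A : Fin d → H →L[ℂ] H) (B : Fin d → K →L[ℂ] K)
    (φ : operatorSystem A →ₗ[ℂ] operatorSystem B) : Prop :=
  φ ⟨1, one_mem_operatorSystem A⟩ = ⟨1, one_mem_operatorSystem B⟩ ∧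
    ∀ i, φ ⟨A i, mem_operatorSystem A i⟩ = ⟨B i, mem_operatorSystem B i⟩

end Maps

/-! A pencil inequality says that a particular element of `Mₙ(S_A)` is positive, so unital
`n`-positive maps carry it to the pencil of `B`. In the non-self-adjoint case this also needs `φ(A*)
= φ(A)*`, which follows from positivity (`IsNPositive.map_star`).

For the converse in 2, span `S_A` by `1` and self-adjoint operators `G k`: the `A i` themselves, or
their real and imaginary parts. If `-∑ c k G k ≥ 0` with `c` real, then the ray through `c` stays in
level one of the spectrahedron, so boundedness forces `c = 0`. Hence `1` and the `G k` are linearly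
independent, the map `1 ↦ 1`, `G k ↦ F k` exists, and `r + ∑ c k G k ≥ 0` implies `r ≥ 0`. Let `C₀ ⊗
1 + ∑ C k ⊗ G k` be positive. Compressing it by vectors shows `C₀ ≥ 0`. After adding `ε` one can
factor `C₀ + ε = D* D` with `D` invertible, and conjugation by `D⁻¹ ⊗ 1` turns the element into a
monic pencil. The inclusion applies there; conjugating back and letting `ε → 0` gives positivity of
the image (`isPositive_blockOp_map_of_subset`).

For 3, equality of the sets gives UCP maps both ways. They are inverse on generators and completely
contractive by the `2 × 2` matrix trick, hence completely isometric. Conversely, a unital complete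
isometry is completely positive, because norms of scalar translates detect positivity
(`ContinuousLinearMap.IsPositive.of_norm_sub_smul_one_le`), and its inverse is of the same kind. -/

open Matrix ComplexConjugate
open scoped ComplexOrder

/-! ### Algebra of operator matrices and elementary tensors. -/

section BlockOperators

variable {H : Type*} [NormedAddCommGroup H] [InnerProductSpace ℂ H] {n : ℕ}

theorem blockOp_add (M N : Matrix (Fin n) (Fin n) (H →L[ℂ] H)) :
    blockOp (M + N) = blockOp M + blockOp N := by
  ext x i
  simp [blockOp_apply, Finset.sum_add_distrib]

theorem blockOp_smul (c : ℂ) (M : Matrix (Fin n) (Fin n) (H →L[ℂ] H)) :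
    blockOp (c • M) = c • blockOp M := by
  ext x i
  simp [blockOp_apply, Finset.smul_sum]

theorem blockOp_zero : blockOp (0 : Matrix (Fin n) (Fin n) (H →L[ℂ] H)) = 0 := by
  ext x i
  simp [blockOp_apply]

theorem blockOp_sub (M N : Matrix (Fin n) (Fin n) (H →L[ℂ] H)) :
    blockOp (M - N) = blockOp M - blockOp N := by
  ext x i
  simp [blockOp_apply, Finset.sum_sub_distrib]

theorem blockOp_sum {ι : Type*} (s : Finset ι)
    (M : ι → Matrix (Fin n) (Fin n) (H →L[ℂ] H)) :
    blockOp (∑ k ∈ s, M k) = ∑ k ∈ s, blockOp (M k) := by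
  classical
  induction s using Finset.induction_on with
  | empty => simp [blockOp_zero]
  | insert a s ha ih => rw [Finset.sum_insert ha, Finset.sum_insert ha, blockOp_add, ih]

theorem blockOp_one : blockOp (1 : Matrix (Fin n) (Fin n) (H →L[ℂ] H)) = 1 := by
  ext x i
  rw [blockOp_apply, Finset.sum_eq_single i]
  · simp
  · intro j _ hj
    simp [Matrix.one_apply_ne hj.symm]
  · simp

theorem blockOp_mul (M N : Matrix (Fin n) (Fin n) (H →L[ℂ] H)) :
    blockOp (M * N) = blockOp M * blockOp N := by
  ext x i
  simp only [blockOp_apply, mul_apply_eq_comp, Matrix.mul_apply,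
    _root_.sum_apply, map_sum]
  exact Finset.sum_comm

theorem blockOp_single (M : Matrix (Fin n) (Fin n) (H →L[ℂ] H)) (i j : Fin n) (y : H) :
    blockOp M (WithLp.toLp 2 (Pi.single j y)) i = M i j y := by
  rw [blockOp_apply, Finset.sum_eq_single j]
  · simp
  · intro k _ hk
    simp [hk]
  · simp

theorem blockOp_injective :
    Function.Injective (blockOp : Matrix (Fin n) (Fin n) (H →L[ℂ] H) → _) := by
  intro M N h
  ext i j y
  rw [← blockOp_single M, h, blockOp_single]

theorem inner_blockOp_left (M : Matrix (Fin n) (Fin n) (H →L[ℂ] H))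
    (x y : PiLp 2 (fun _ : Fin n => H)) :
    inner ℂ (blockOp M x) y = ∑ i, ∑ j, inner ℂ (M i j (x j)) (y i) := by
  simp only [PiLp.inner_apply, blockOp_apply, sum_inner]

theorem blockOp_star [CompleteSpace H] (M : Matrix (Fin n) (Fin n) (H →L[ℂ] H)) :
    blockOp (star M) = star (blockOp M) := by
  rw [ContinuousLinearMap.star_eq_adjoint, ContinuousLinearMap.eq_adjoint_iff]
  intro x y
  rw [inner_blockOp_left, ← inner_conj_symm, inner_blockOp_left, map_sum, Finset.sum_comm]
  refine Finset.sum_congr rfl fun i _ => ?_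
  rw [map_sum]
  refine Finset.sum_congr rfl fun j _ => ?_
  rw [inner_conj_symm, Matrix.star_apply, ContinuousLinearMap.star_eq_adjoint,
    ContinuousLinearMap.adjoint_inner_left]

/-- The matrix over `B(H)` representing the tensor product `T ⊗ C`. -/
def tensorMatrix (C : Matrix (Fin n) (Fin n) ℂ) (T : H →L[ℂ] H) :
    Matrix (Fin n) (Fin n) (H →L[ℂ] H) :=
  Matrix.of fun i j => C i j • T

theorem tensorMatrix_apply (C : Matrix (Fin n) (Fin n) ℂ) (T : H →L[ℂ] H) (i j : Fin n) :
    tensorMatrix C T i j = C i j • T := rfl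

theorem tensorMatrix_mul (C D : Matrix (Fin n) (Fin n) ℂ) (S T : H →L[ℂ] H) :
    tensorMatrix C S * tensorMatrix D T = tensorMatrix (C * D) (S * T) := by
  ext1 i j
  simp only [Matrix.mul_apply, tensorMatrix_apply, Finset.sum_smul, smul_mul_smul_comm]

theorem tensorMatrix_one : tensorMatrix (1 : Matrix (Fin n) (Fin n) ℂ) (1 : H →L[ℂ] H) = 1 := by
  ext1 i j
  by_cases h : i = j
  · subst h; simp [tensorMatrix_apply]
  · simp [tensorMatrix_apply, h]

theorem tensorMatrix_star [CompleteSpace H] (C : Matrix (Fin n) (Fin n) ℂ) (T : H →L[ℂ] H) :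
    star (tensorMatrix C T) = tensorMatrix (star C) (star T) := by
  ext1 i j
  simp [tensorMatrix_apply, Matrix.star_apply]

theorem tensorMatrix_add_left (C D : Matrix (Fin n) (Fin n) ℂ) (T : H →L[ℂ] H) :
    tensorMatrix (C + D) T = tensorMatrix C T + tensorMatrix D T := by
  ext1 i j
  simp [tensorMatrix_apply, add_smul]

theorem tensorMatrix_neg_left (C : Matrix (Fin n) (Fin n) ℂ) (T : H →L[ℂ] H) :
    tensorMatrix (-C) T = -tensorMatrix C T := by
  ext1 i j
  simp [tensorMatrix_apply]

theorem tensorMatrix_smul_left (c : ℂ) (C : Matrix (Fin n) (Fin n) ℂ) (T : H →L[ℂ] H) :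
    tensorMatrix (c • C) T = c • tensorMatrix C T := by
  ext1 i j
  simp [tensorMatrix_apply, mul_smul]

theorem linearPencil_eq {d : ℕ} (A : Fin d → H →L[ℂ] H) (X : Fin d → Matrix (Fin n) (Fin n) ℂ) :
    linearPencil A X = blockOp (1 - ∑ k, tensorMatrix (X k) (A k)) := by
  rw [blockOp_sub, blockOp_sum, blockOp_one]
  rfl

theorem isPositive_of_forall_add_smul_one {T : H →L[ℂ] H}
    (h : ∀ ε : ℝ, 0 < ε → (T + (ε : ℂ) • 1).IsPositive) : T.IsPositive := by
  rw [ContinuousLinearMap.isPositive_iff_complex]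
  intro x
  have key : ∀ ε : ℝ, 0 < ε → (inner ℂ (T x) x).im = 0 ∧
      0 ≤ (inner ℂ (T x) x).re + ε * ‖x‖ ^ 2 := by
    intro ε hε
    have h1 := (h ε hε).inner_nonneg_left x
    rw [RCLike.nonneg_iff] at h1
    have h2 : inner ℂ ((T + (ε : ℂ) • 1) x) x = inner ℂ (T x) x + ((ε * ‖x‖ ^ 2 : ℝ) : ℂ) := by
      simp [inner_self_eq_norm_sq_to_K]
    rw [h2] at h1
    simp only [map_add, RCLike.re_to_complex, RCLike.im_to_complex, Complex.ofReal_re,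
      Complex.ofReal_im, add_zero] at h1
    exact ⟨h1.2, h1.1⟩
  refine ⟨Complex.ext rfl ?_, ?_⟩
  · simpa using ((key 1 one_pos).1).symm
  · change 0 ≤ (inner ℂ (T x) x).re
    by_contra! hneg
    by_cases hx : ‖x‖ ^ 2 = 0
    · have := (key 1 one_pos).2
      rw [hx] at this
      linarith
    · have hx0 : ‖x‖ ≠ 0 := fun h0 => hx (by simp [h0])
      have hx' : 0 < ‖x‖ ^ 2 := lt_of_le_of_ne (by positivity) (Ne.symm hx)
      -- This `ε` cancels only half of the supposedly negative value, leaving a negative number.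
      have := (key (-(inner ℂ (T x) x).re / (2 * ‖x‖ ^ 2))
        (div_pos (by linarith) (by positivity))).2
      have e : -(inner ℂ (T x) x).re / (2 * ‖x‖ ^ 2) * ‖x‖ ^ 2 = -(inner ℂ (T x) x).re / 2 := by
        field_simp
      rw [e] at this
      linarith

/-- Compression of an operator on `Hⁿ` by a vector of `ℂⁿ`. -/
theorem isPositive_compression {M : Matrix (Fin n) (Fin n) (H →L[ℂ] H)}
    (hM : (blockOp M).IsPositive) (v : Fin n → ℂ) :
    (∑ i, ∑ j, (conj (v i) * v j) • M i j).IsPositive := by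
  rw [ContinuousLinearMap.isPositive_iff_complex] at hM ⊢
  intro y
  have := hM (WithLp.toLp 2 fun i => v i • y)
  rw [inner_blockOp_left] at this
  have e : inner ℂ ((∑ i, ∑ j, (conj (v i) * v j) • M i j) y) y =
      ∑ i, ∑ j, inner ℂ (M i j (v j • y)) (v i • y) := by
    simp only [_root_.sum_apply, sum_inner]
    refine Finset.sum_congr rfl fun i _ => Finset.sum_congr rfl fun j _ => ?_
    simp only [_root_.smul_apply, map_smul, inner_smul_left, inner_smul_right,
      map_mul, Complex.conj_conj]
    ring
  rw [e]
  exact this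

/-- The quadratic form of `T ⊗ 1` is a sum of `n` copies of that of `T`. For `n = 0` there is no
copy from which to recover `T`. -/
theorem isPositive_blockOp_scalar_iff (hn : n ≠ 0) (T : H →L[ℂ] H) :
    (blockOp (tensorMatrix (1 : Matrix (Fin n) (Fin n) ℂ) T)).IsPositive ↔ T.IsPositive := by
  constructor
  · intro h
    have := isPositive_compression h (Pi.single ⟨0, Nat.pos_of_ne_zero hn⟩ 1)
    simpa [tensorMatrix_apply, Pi.single_apply, Matrix.one_apply] using this
  · intro h
    rw [ContinuousLinearMap.isPositive_iff_complex] at h ⊢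
    intro x
    have e : inner ℂ (blockOp (tensorMatrix (1 : Matrix (Fin n) (Fin n) ℂ) T) x) x =
        ∑ i, inner ℂ (T (x i)) (x i) := by
      rw [inner_blockOp_left]
      refine Finset.sum_congr rfl fun i _ => ?_
      rw [Finset.sum_eq_single i]
      · simp [tensorMatrix_apply]
      · intro j _ hj
        simp [tensorMatrix_apply, Matrix.one_apply_ne hj.symm]
      · simp
    rw [e, map_sum]
    refine ⟨?_, Finset.sum_nonneg fun i _ => (h (x i)).2⟩
    push_cast
    exact Finset.sum_congr rfl fun i _ => (h (x i)).1

end BlockOperators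

/-! ### Congruence, and norm bounds as positivity of `2 × 2` blocks. -/

section Positivity

variable {H : Type*} [NormedAddCommGroup H] [InnerProductSpace ℂ H] [CompleteSpace H] {n : ℕ}

theorem ContinuousLinearMap.IsPositive.star_mul_mul {T : H →L[ℂ] H} (hT : T.IsPositive)
    (S : H →L[ℂ] H) : (star S * T * S).IsPositive := by
  have := hT.adjoint_conj S
  rwa [← ContinuousLinearMap.star_eq_adjoint] at this

theorem isPositive_blockOp_star_mul_mul {M : Matrix (Fin n) (Fin n) (H →L[ℂ] H)}
    (hM : (blockOp M).IsPositive) (N : Matrix (Fin n) (Fin n) (H →L[ℂ] H)) :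
    (blockOp (star N * M * N)).IsPositive := by
  rw [blockOp_mul, blockOp_mul, blockOp_star]
  exact hM.star_mul_mul _

/-- The `2 × 2` operator matrix `[[r, M], [M*, r]]`. -/
noncomputable def normBlock (r : ℂ) (M : Matrix (Fin n) (Fin n) (H →L[ℂ] H)) :
    Matrix (Fin (n + n)) (Fin (n + n)) (H →L[ℂ] H) :=
  (Matrix.fromBlocks (r • 1) M (star M) (r • 1)).submatrix finSumFinEquiv.symm finSumFinEquiv.symm

theorem inner_normBlock (r : ℝ) (M : Matrix (Fin n) (Fin n) (H →L[ℂ] H))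
    (u v : PiLp 2 (fun _ : Fin n => H)) :
    inner ℂ (blockOp (normBlock r M) (WithLp.toLp 2 (Fin.append u v)))
      (WithLp.toLp 2 (Fin.append u v)) =
      ((r * ‖u‖ ^ 2 + r * ‖v‖ ^ 2 + 2 * (inner ℂ (blockOp M v) u).re : ℝ) : ℂ) := by
  have h1 : ∀ w : PiLp 2 (fun _ : Fin n => H), ∑ i, ∑ j,
      inner ℂ (((r : ℂ) • (1 : Matrix (Fin n) (Fin n) (H →L[ℂ] H))) i j (w j)) (w i) =
      ((r * ‖w‖ ^ 2 : ℝ) : ℂ) := by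
    intro w
    rw [← inner_blockOp_left, blockOp_smul, blockOp_one]
    simp [inner_self_eq_norm_sq_to_K]
  have h2 : ∑ i, ∑ j, inner ℂ ((star M) i j (u j)) (v i) = conj (inner ℂ (blockOp M v) u) := by
    rw [← inner_blockOp_left, blockOp_star, ContinuousLinearMap.star_eq_adjoint,
      ContinuousLinearMap.adjoint_inner_left, inner_conj_symm]
  rw [inner_blockOp_left, Fin.sum_univ_add]
  simp only [Fin.sum_univ_add, normBlock, Matrix.submatrix_apply, finSumFinEquiv_symm_apply_castAdd,
    finSumFinEquiv_symm_apply_natAdd, Matrix.fromBlocks_apply₁₁, Matrix.fromBlocks_apply₁₂,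
    Matrix.fromBlocks_apply₂₁, Matrix.fromBlocks_apply₂₂, Fin.append_left, Fin.append_right,
    Finset.sum_add_distrib, h1, h2]
  rw [← inner_blockOp_left]
  have h3 := Complex.add_conj (inner ℂ (blockOp M v) u)
  push_cast at h3 ⊢
  linear_combination h3

theorem isPositive_normBlock {r : ℝ} {M : Matrix (Fin n) (Fin n) (H →L[ℂ] H)}
    (h : ‖blockOp M‖ ≤ r) : (blockOp (normBlock r M)).IsPositive := by
  rw [ContinuousLinearMap.isPositive_iff_complex]
  intro x
  set u : PiLp 2 (fun _ : Fin n => H) := WithLp.toLp 2 fun i => x (Fin.castAdd n i) with hu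
  set v : PiLp 2 (fun _ : Fin n => H) := WithLp.toLp 2 fun i => x (Fin.natAdd n i) with hv
  have hx : x = WithLp.toLp 2 (Fin.append u v) := by
    ext i
    refine Fin.addCases (fun i => ?_) (fun i => ?_) i
    · simp only [Fin.append_left, hu]
    · simp only [Fin.append_right, hv]
  rw [hx, inner_normBlock]
  refine ⟨by rw [RCLike.re_to_complex, Complex.ofReal_re], ?_⟩
  simp only [RCLike.re_to_complex, Complex.ofReal_re]
  have h1 : |(inner ℂ (blockOp M v) u).re| ≤ r * ‖v‖ * ‖u‖ :=
    (Complex.abs_re_le_norm _).trans <| (norm_inner_le_norm _ _).trans <| by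
      gcongr
      exact (blockOp M).le_of_opNorm_le h v
  have h2 := neg_le_of_abs_le h1
  have h3 : 0 ≤ r := (norm_nonneg _).trans h
  -- The cross term is at least `-2r‖u‖‖v‖`, so the form is at least `r(‖u‖ - ‖v‖)²`.
  nlinarith [mul_nonneg h3 (sq_nonneg (‖u‖ - ‖v‖))]

theorem norm_le_of_isPositive_normBlock {r : ℝ} (hr : 0 < r)
    {M : Matrix (Fin n) (Fin n) (H →L[ℂ] H)}
    (h : (blockOp (normBlock r M)).IsPositive) : ‖blockOp M‖ ≤ r := by
  refine ContinuousLinearMap.opNorm_le_bound _ hr.le fun v => ?_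
  -- Testing on `(-Mv, rv)` gives `r³‖v‖² - r‖Mv‖² ≥ 0`; dividing by `r > 0` yields the bound.
  have h1 := h.inner_nonneg_left
    (WithLp.toLp 2 (Fin.append (-blockOp M v : PiLp 2 (fun _ : Fin n => H))
      ((r : ℂ) • v : PiLp 2 (fun _ : Fin n => H))))
  rw [inner_normBlock] at h1
  rw [RCLike.nonneg_iff] at h1
  have h2 := h1.1
  simp only [RCLike.re_to_complex, Complex.ofReal_re, map_smul, inner_smul_left, inner_neg_right,
    inner_self_eq_norm_sq_to_K, norm_neg, norm_smul, Complex.conj_ofReal] at h2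
  have h4 : -((r : ℂ) * (‖blockOp M v‖ : ℂ) ^ 2) = ((-(r * ‖blockOp M v‖ ^ 2) : ℝ) : ℂ) := by
    push_cast; ring
  simp only [Complex.coe_algebraMap, Complex.norm_real, Real.norm_eq_abs, abs_of_pos hr] at h2
  rw [h4, Complex.ofReal_re] at h2
  have h5 : r * ‖blockOp M v‖ ^ 2 ≤ r * (r * ‖v‖) ^ 2 := by nlinarith
  have h6 := le_of_mul_le_mul_left h5 hr
  exact le_of_sq_le_sq h6 (by positivity)

end Positivity

/-! ### Self-adjoint pencils with no recession direction, and positivity of the induced map. -/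

section Pencils

variable {H : Type*} [NormedAddCommGroup H] [InnerProductSpace ℂ H] {ι : Type*} [Fintype ι]
  {G : ι → H →L[ℂ] H}

/-- On the zero space every operator is positive, so `hb` would force the constant tuple `1` to
vanish. This is where `d ≥ 1` matters. -/
theorem nontrivial_of_forall_isPositive_neg_sum [Nonempty ι]
    (hb : ∀ c : ι → ℝ, (-∑ k, (c k : ℂ) • G k).IsPositive → c = 0) : Nontrivial H := by
  by_contra h
  rw [not_nontrivial_iff_subsingleton] at h
  have h0 : (-∑ k, (((1 : ι → ℝ) k : ℝ) : ℂ) • G k) = 0 := by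
    ext x
    exact Subsingleton.elim _ _
  have h1 := hb 1 (h0 ▸ ContinuousLinearMap.isPositive_zero)
  exact one_ne_zero (congrFun h1 (Classical.arbitrary ι))

theorem isPositive_ofReal_smul_one {r : ℝ} (hr : 0 ≤ r) :
    ((r : ℂ) • (1 : H →L[ℂ] H)).IsPositive :=
  ContinuousLinearMap.isPositive_one.smul_of_nonneg (by simpa using hr)

/-- If `r < 0`, adding `-r` leaves `∑ c k G k ≥ 0`, so `c = 0` by `hb`; then `r • 1 ≥ 0` on a
nonzero space, a contradiction. -/
theorem nonneg_of_isPositive_smul_one_add_sum [Nontrivial H]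
    (hb : ∀ c : ι → ℝ, (-∑ k, (c k : ℂ) • G k).IsPositive → c = 0) (r : ℝ) (c : ι → ℝ)
    (h : ((r : ℂ) • (1 : H →L[ℂ] H) + ∑ k, (c k : ℂ) • G k).IsPositive) : 0 ≤ r := by
  by_contra! hr
  have h1 := h.add (isPositive_ofReal_smul_one (H := H) (r := -r) (by linarith))
  have h2 : (-∑ k, (((-c) k : ℝ) : ℂ) • G k).IsPositive := by
    convert h1 using 1
    simp only [Pi.neg_apply, Complex.ofReal_neg, neg_smul, Finset.sum_neg_distrib]
    abel
  have h3 : c = 0 := by simpa using hb (-c) h2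
  obtain ⟨x, hx⟩ := exists_ne (0 : H)
  have h4 := h.re_inner_nonneg_left x
  have h5 : inner ℂ (((r : ℂ) • (1 : H →L[ℂ] H) + ∑ k, (c k : ℂ) • G k) x) x =
      ((r * ‖x‖ ^ 2 : ℝ) : ℂ) := by
    simp [h3, inner_self_eq_norm_sq_to_K]
  rw [h5, RCLike.re_to_complex, Complex.ofReal_re] at h4
  have : 0 < ‖x‖ ^ 2 := by positivity
  nlinarith

theorem eq_zero_of_smul_one_add_sum_eq_zero_of_real [Nontrivial H]
    (hb : ∀ c : ι → ℝ, (-∑ k, (c k : ℂ) • G k).IsPositive → c = 0) (r : ℝ) (c : ι → ℝ)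
    (h : (r : ℂ) • (1 : H →L[ℂ] H) + ∑ k, (c k : ℂ) • G k = 0) : r = 0 ∧ c = 0 := by
  have h1 := nonneg_of_isPositive_smul_one_add_sum hb r c
    (h ▸ ContinuousLinearMap.isPositive_zero)
  have h2 := nonneg_of_isPositive_smul_one_add_sum hb (-r) (-c) (by
    convert ContinuousLinearMap.isPositive_zero (𝕜 := ℂ) (E := H) using 1
    rw [← neg_eq_zero, ← h]
    simp only [Pi.neg_apply, Complex.ofReal_neg, neg_smul, Finset.sum_neg_distrib]
    abel)
  have h3 : r = 0 := by linarith
  refine ⟨h3, hb c ?_⟩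
  rw [h3, Complex.ofReal_zero, zero_smul, zero_add] at h
  rw [h, neg_zero]
  exact ContinuousLinearMap.isPositive_zero

/-- The adjoint of a linear relation has the conjugate coefficients, so the real and imaginary parts
of the coefficients are themselves real relations, and these are trivial. -/
theorem linearIndependent_one_of_bounded [CompleteSpace H] [Nontrivial H]
    (hG : ∀ k, IsSelfAdjoint (G k))
    (hb : ∀ c : ι → ℝ, (-∑ k, (c k : ℂ) • G k).IsPositive → c = 0) :
    LinearIndependent ℂ (fun o : Option ι => o.elim (1 : H →L[ℂ] H) G) := by
  rw [Fintype.linearIndependent_iff]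
  intro g hg
  simp only [Fintype.sum_option, Option.elim_none, Option.elim_some] at hg
  have hs : conj (g none) • (1 : H →L[ℂ] H) + ∑ k, conj (g (some k)) • G k = 0 := by
    have := congrArg star hg
    simpa [star_sum, (hG _).star_eq] using this
  have hre := eq_zero_of_smul_one_add_sum_eq_zero_of_real hb (g none).re (fun k => (g (some k)).re)
    (by
      simp only [Complex.re_eq_add_conj, div_eq_inv_mul, mul_smul, add_smul, ← Finset.smul_sum,
        Finset.sum_add_distrib, ← smul_add]
      rw [add_add_add_comm, hg, hs]
      simp)
  have him := eq_zero_of_smul_one_add_sum_eq_zero_of_real hb (g none).im (fun k => (g (some k)).im)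
    (by
      simp only [Complex.im_eq_sub_conj, div_eq_inv_mul, mul_smul, sub_smul, ← Finset.smul_sum,
        Finset.sum_sub_distrib, ← smul_add]
      rw [sub_add_sub_comm, hg, hs]
      simp)
  rintro (_ | k)
  · exact Complex.ext hre.1 him.1
  · exact Complex.ext (congrFun hre.2 k) (congrFun him.2 k)

variable {K : Type*} [NormedAddCommGroup K] [InnerProductSpace ℂ K] {F : ι → K →L[ℂ] K}

/-- The extension beyond the span is arbitrary and purely algebraic; only its values on `S_A` will
be used. -/
theorem exists_linearMap_of_linearIndependent {V W κ : Type*} [AddCommGroup V] [Module ℂ V]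
    [AddCommGroup W] [Module ℂ W] {v : κ → V} (hv : LinearIndependent ℂ v) (w : κ → W) :
    ∃ f : V →ₗ[ℂ] W, ∀ k, f (v k) = w k := by
  obtain ⟨f, hf⟩ := LinearMap.exists_extend ((Module.Basis.span hv).constr ℂ w)
  refine ⟨f, fun k => ?_⟩
  have h1 := LinearMap.congr_fun hf (Module.Basis.span hv k)
  rw [Module.Basis.constr_basis] at h1
  rw [← h1, LinearMap.comp_apply, Submodule.subtype_apply, Module.Basis.span_apply]

theorem Matrix.PosDef.exists_isUnit_star_mul_self {n : ℕ} {C : Matrix (Fin n) (Fin n) ℂ}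
    (hC : C.PosDef) : ∃ D : Matrix (Fin n) (Fin n) ℂ, IsUnit D ∧ C = star D * D := by
  open scoped MatrixOrder Matrix.Norms.L2Operator in
  exact CStarAlgebra.isStrictlyPositive_iff_eq_star_mul_self.mp hC.isStrictlyPositive

variable {n : ℕ}

theorem exists_tensorMatrix_eq (M : Matrix (Fin n) (Fin n) (H →L[ℂ] H))
    (hM : ∀ i j, M i j ∈ Submodule.span ℂ (insert 1 (Set.range G))) :
    ∃ (C₀ : Matrix (Fin n) (Fin n) ℂ) (C : ι → Matrix (Fin n) (Fin n) ℂ),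
      M = tensorMatrix C₀ 1 + ∑ k, tensorMatrix (C k) (G k) := by
  have h : ∀ i j, ∃ c : Option ι → ℂ, c none • 1 + ∑ k, c (some k) • G k = M i j := by
    intro i j
    have h1 : (insert 1 (Set.range G)) =
        Set.range (fun o : Option ι => o.elim (1 : H →L[ℂ] H) G) := by
      ext T
      simp [Option.exists, eq_comm]
    have h2 := hM i j
    rw [h1, Submodule.mem_span_range_iff_exists_fun] at h2
    obtain ⟨c, hc⟩ := h2
    exact ⟨c, by simpa [Fintype.sum_option] using hc⟩
  choose c hc using h
  refine ⟨Matrix.of fun i j => c i j none, fun k => Matrix.of fun i j => c i j (some k), ?_⟩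
  ext1 i j
  simp [tensorMatrix_apply, Matrix.sum_apply, ← hc]

theorem sum_smul_tensorMatrix_add (w : Fin n → Fin n → ℂ) (C₀ : Matrix (Fin n) (Fin n) ℂ)
    (C : ι → Matrix (Fin n) (Fin n) ℂ) (T₀ : H →L[ℂ] H) (T : ι → H →L[ℂ] H) :
    ∑ i, ∑ j, w i j • (tensorMatrix C₀ T₀ + ∑ k, tensorMatrix (C k) (T k) :
        Matrix (Fin n) (Fin n) (H →L[ℂ] H)) i j =
      (∑ i, ∑ j, w i j * C₀ i j) • T₀ + ∑ k, (∑ i, ∑ j, w i j * C k i j) • T k := by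
  simp only [Matrix.add_apply, Matrix.sum_apply, tensorMatrix_apply, smul_add, Finset.smul_sum,
    smul_smul, Finset.sum_add_distrib, Finset.sum_smul]
  congr 1
  rw [Finset.sum_congr rfl fun i _ => Finset.sum_comm, Finset.sum_comm]

theorem blockOp_add_smul_one (C : Matrix (Fin n) (Fin n) ℂ)
    (N : Matrix (Fin n) (Fin n) (H →L[ℂ] H)) (z : ℂ) :
    blockOp (tensorMatrix C 1 + N) + z • 1 = blockOp (tensorMatrix (C + z • 1) 1 + N) := by
  rw [tensorMatrix_add_left, tensorMatrix_smul_left, tensorMatrix_one, add_right_comm,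
    blockOp_add _ (z • 1), blockOp_smul, blockOp_one]

variable [CompleteSpace H] [CompleteSpace K]

/-- Linear independence lets one compare coefficients in each entry of the matrix and of its
adjoint. -/
theorem isHermitian_of_isSelfAdjoint_tensorMatrix
    (hG : ∀ k, IsSelfAdjoint (G k))
    (hv : LinearIndependent ℂ (fun o : Option ι => o.elim (1 : H →L[ℂ] H) G))
    {C₀ : Matrix (Fin n) (Fin n) ℂ} {C : ι → Matrix (Fin n) (Fin n) ℂ}
    (h : IsSelfAdjoint (tensorMatrix C₀ 1 + ∑ k, tensorMatrix (C k) (G k))) :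
    C₀.IsHermitian ∧ ∀ k, (C k).IsHermitian := by
  have h1 : ∀ i j, ∀ o : Option ι, o.elim (star C₀ i j - C₀ i j)
      (fun k => star (C k) i j - C k i j) = 0 := by
    intro i j
    have h2 := congrFun (congrFun h.star_eq i) j
    simp only [star_add, star_sum, tensorMatrix_star, (hG _).star_eq, star_one, Matrix.add_apply,
      Matrix.sum_apply, tensorMatrix_apply] at h2
    refine Fintype.linearIndependent_iff.mp hv _ ?_
    simp only [Fintype.sum_option, Option.elim_none, Option.elim_some, sub_smul,
      Finset.sum_sub_distrib]
    rw [sub_add_sub_comm, h2, sub_self]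
  refine ⟨?_, fun k => ?_⟩
  · ext i j
    exact sub_eq_zero.mp (h1 i j none)
  · ext i j
    exact sub_eq_zero.mp (h1 i j (some k))

theorem star_tensorMatrix_mul_pencil_mul (T : ι → H →L[ℂ] H) {D : Matrix (Fin n) (Fin n) ℂ}
    {X C : ι → Matrix (Fin n) (Fin n) ℂ} (hDX : ∀ k, star D * X k * D = -C k) :
    star (tensorMatrix D 1) * (1 - ∑ k, tensorMatrix (X k) (T k)) * tensorMatrix D 1 =
      tensorMatrix (star D * D) 1 + ∑ k, tensorMatrix (C k) (T k) := by
  rw [tensorMatrix_star, star_one, mul_sub, sub_mul, mul_one, tensorMatrix_mul, one_mul,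
    Finset.mul_sum, Finset.sum_mul, sub_eq_add_neg, ← Finset.sum_neg_distrib]
  congr 1
  refine Finset.sum_congr rfl fun k _ => ?_
  rw [tensorMatrix_mul, tensorMatrix_mul, hDX, one_mul, mul_one, tensorMatrix_neg_left, neg_neg]

/-- If the free spectrahedron of the pencil `G` is bounded and contained in that of `F`, then
the map `1 ↦ 1`, `G k ↦ F k` is completely positive. -/
theorem isPositive_blockOp_map_of_subset [Nontrivial H] (hG : ∀ k, IsSelfAdjoint (G k))
    (hb : ∀ c : ι → ℝ, (-∑ k, (c k : ℂ) • G k).IsPositive → c = 0)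
    (hGF : ∀ X : ι → Matrix (Fin n) (Fin n) ℂ, (∀ k, (X k).IsHermitian) →
      (blockOp (1 - ∑ k, tensorMatrix (X k) (G k))).IsPositive →
      (blockOp (1 - ∑ k, tensorMatrix (X k) (F k))).IsPositive)
    (f : (H →L[ℂ] H) →ₗ[ℂ] (K →L[ℂ] K)) (f_one : f 1 = 1) (f_G : ∀ k, f (G k) = F k)
    (M : Matrix (Fin n) (Fin n) (H →L[ℂ] H))
    (hM : ∀ i j, M i j ∈ Submodule.span ℂ (insert 1 (Set.range G)))
    (hpos : (blockOp M).IsPositive) : (blockOp (M.map f)).IsPositive := by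
  obtain ⟨C₀, C, rfl⟩ := exists_tensorMatrix_eq M hM
  have hfM : (tensorMatrix C₀ 1 + ∑ k, tensorMatrix (C k) (G k)).map f =
      tensorMatrix C₀ 1 + ∑ k, tensorMatrix (C k) (F k) := by
    ext1 i j
    simp [tensorMatrix_apply, Matrix.sum_apply, f_one, f_G]
  rw [hfM]
  have hsa : IsSelfAdjoint (tensorMatrix C₀ 1 + ∑ k, tensorMatrix (C k) (G k)) := by
    apply blockOp_injective
    rw [blockOp_star]
    exact hpos.isSelfAdjoint.star_eq
  obtain ⟨hC₀, hC⟩ := isHermitian_of_isSelfAdjoint_tensorMatrix hG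
    (linearIndependent_one_of_bounded hG hb) hsa
  have hpsd : C₀.PosSemidef := by
    refine Matrix.PosSemidef.of_dotProduct_mulVec_nonneg hC₀ fun v => ?_
    have hreal : ∀ D : Matrix (Fin n) (Fin n) ℂ, D.IsHermitian →
        ∑ i, ∑ j, conj (v i) * v j * D i j = (((star v ⬝ᵥ D *ᵥ v).re : ℝ) : ℂ) := by
      intro D hD
      have h1 : ∑ i, ∑ j, conj (v i) * v j * D i j = star v ⬝ᵥ D *ᵥ v := by
        simp only [dotProduct, mulVec, Finset.mul_sum, Pi.star_apply]
        exact Finset.sum_congr rfl fun i _ => Finset.sum_congr rfl fun j _ => by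
          rw [starRingEnd_apply]; ring
      rw [h1]
      exact Complex.ext rfl (by simpa using hD.im_star_dotProduct_mulVec_self v)
    -- Compression by `v` produces `(v*C₀v) • 1 + ∑ (v*C k v) • G k`, whose coefficients are real
    -- because the matrices are Hermitian; its constant term must then be nonnegative.
    have h2 := isPositive_compression hpos v
    rw [sum_smul_tensorMatrix_add, hreal _ hC₀] at h2
    simp only [hreal _ (hC _)] at h2
    have h4 := nonneg_of_isPositive_smul_one_add_sum hb _ _ h2
    rw [Complex.nonneg_iff]
    exact ⟨h4, (by simpa using hC₀.im_star_dotProduct_mulVec_self v : _ = _).symm⟩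
  -- `C₀` is only semidefinite; the shift by `ε` makes it invertible and is removed in the limit.
  refine isPositive_of_forall_add_smul_one fun ε hε => ?_
  have hpd : (C₀ + (ε : ℂ) • 1).PosDef :=
    Matrix.PosDef.posSemidef_add hpsd (Matrix.PosDef.one.smul (by simpa using hε))
  obtain ⟨D, hD, hDeq⟩ := hpd.exists_isUnit_star_mul_self
  obtain ⟨E, hDE, hED⟩ := isUnit_iff_exists.mp hD
  -- With `E = D⁻¹`, this is the tuple whose monic pencil becomes the shifted element after
  -- conjugation by `D ⊗ 1`; the sign matches `1 - ∑`.
  set X : ι → Matrix (Fin n) (Fin n) ℂ := fun k => -(star E * C k * E) with hX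
  have hstar : star D * star E = 1 := by rw [← star_mul, hED, star_one]
  have hstar' : star E * star D = 1 := by rw [← star_mul, hDE, star_one]
  have hDX : ∀ k, star D * X k * D = -C k := by
    intro k
    rw [hX]
    simp only [mul_neg, neg_mul, neg_inj]
    calc star D * (star E * C k * E) * D = (star D * star E) * C k * (E * D) := by
          simp only [mul_assoc]
      _ = C k := by rw [hstar, hED, one_mul, mul_one]
  have hXh : ∀ k, (X k).IsHermitian := by
    intro k
    have h1 : star (C k) = C k := hC k
    change star (X k) = X k
    simp only [hX, star_neg, star_mul, star_star, h1, mul_assoc]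
  have hposε := hpos.add (isPositive_ofReal_smul_one hε.le)
  rw [blockOp_add_smul_one, hDeq, ← star_tensorMatrix_mul_pencil_mul G hDX] at hposε
  have h5 := isPositive_blockOp_star_mul_mul hposε (tensorMatrix E 1)
  have h6 : star (tensorMatrix E (1 : H →L[ℂ] H)) * star (tensorMatrix D 1) = 1 := by
    rw [tensorMatrix_star, tensorMatrix_star, tensorMatrix_mul, star_one, one_mul, hstar',
      tensorMatrix_one]
  have h7 : tensorMatrix D (1 : H →L[ℂ] H) * tensorMatrix E 1 = 1 := by
    rw [tensorMatrix_mul, one_mul, hDE, tensorMatrix_one]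
  have h8 : ∀ N : Matrix (Fin n) (Fin n) (H →L[ℂ] H), star (tensorMatrix E (1 : H →L[ℂ] H)) *
      (star (tensorMatrix D 1) * N * tensorMatrix D 1) * tensorMatrix E 1 = N := by
    intro N
    calc _ = (star (tensorMatrix E (1 : H →L[ℂ] H)) * star (tensorMatrix D 1)) * N *
          (tensorMatrix D 1 * tensorMatrix E 1) := by simp only [mul_assoc]
      _ = N := by rw [h6, h7, one_mul, mul_one]
  rw [h8] at h5
  rw [blockOp_add_smul_one, hDeq, ← star_tensorMatrix_mul_pencil_mul F hDX]
  exact isPositive_blockOp_star_mul_mul (hGF X hXh h5) _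

end Pencils

/-! ### Detecting positivity from norms of scalar translates. -/

section NumericalRange

variable {H K : Type*} [NormedAddCommGroup H] [InnerProductSpace ℂ H]
  [NormedAddCommGroup K] [InnerProductSpace ℂ K]

/-- As `⟨Ty, y⟩` is real, the cross term vanishes: `‖(T - is)y‖² = ‖Ty‖² + s²‖y‖²`. -/
theorem ContinuousLinearMap.IsPositive.norm_sub_I_smul_one_sq_le {T : H →L[ℂ] H}
    (hT : T.IsPositive) (s : ℝ) :
    ‖T - (s * Complex.I : ℂ) • 1‖ ^ 2 ≤ ‖T‖ ^ 2 + s ^ 2 := by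
  have h0 : 0 ≤ ‖T‖ ^ 2 + s ^ 2 := by positivity
  have h : ‖T - (s * Complex.I : ℂ) • 1‖ ≤ √(‖T‖ ^ 2 + s ^ 2) := by
    refine ContinuousLinearMap.opNorm_le_bound _ (Real.sqrt_nonneg _) fun y => ?_
    refine le_of_sq_le_sq ?_ (by positivity)
    rw [mul_pow, Real.sq_sqrt h0]
    have h1 := (RCLike.nonneg_iff.mp (hT.inner_nonneg_left y)).2
    rw [RCLike.im_to_complex] at h1
    have h2 : ‖(T - (s * Complex.I : ℂ) • 1) y‖ ^ 2 = ‖T y‖ ^ 2 + s ^ 2 * ‖y‖ ^ 2 := by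
      have h3 : (T - (s * Complex.I : ℂ) • 1) y = T y - (s * Complex.I : ℂ) • y := rfl
      rw [h3, @norm_sub_sq ℂ, inner_smul_right, norm_smul]
      simp [h1, mul_pow]
    rw [h2]
    have h4 := T.le_opNorm y
    have h5 : ‖T y‖ ^ 2 ≤ (‖T‖ * ‖y‖) ^ 2 := by gcongr
    nlinarith
  calc _ ≤ √(‖T‖ ^ 2 + s ^ 2) ^ 2 := by gcongr
    _ = _ := Real.sq_sqrt h0

variable [CompleteSpace H]

theorem IsSelfAdjoint.isPositive_add_norm_smul_one {T : H →L[ℂ] H} (hT : IsSelfAdjoint T) :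
    (T + (‖T‖ : ℂ) • 1).IsPositive := by
  have h := hT.neg_algebraMap_norm_le_self
  rw [ContinuousLinearMap.le_def, sub_neg_eq_add, Algebra.algebraMap_eq_smul_one] at h
  exact h

/-- This follows from `0 ≤ ‖T‖ - T ≤ ‖T‖`. -/
theorem ContinuousLinearMap.IsPositive.norm_sub_norm_smul_one_le {T : H →L[ℂ] H}
    (hT : T.IsPositive) : ‖T - (‖T‖ : ℂ) • 1‖ ≤ ‖T‖ := by
  have h0 : 0 ≤ T := (ContinuousLinearMap.nonneg_iff_isPositive T).mpr hT
  have h1 := hT.isSelfAdjoint.le_algebraMap_norm_self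
  have h2 : algebraMap ℝ (H →L[ℂ] H) ‖T‖ = (‖T‖ : ℂ) • 1 := by
    rw [Algebra.algebraMap_eq_smul_one]
    rfl
  rw [norm_sub_rev, ← h2]
  exact (CStarAlgebra.norm_le_iff_le_algebraMap _ (norm_nonneg T) (sub_nonneg.mpr h1)).mpr
    (sub_le_self _ h0)

/-- An operator all of whose scalar translates are dominated in norm by those of a positive
operator is positive. -/
theorem ContinuousLinearMap.IsPositive.of_norm_sub_smul_one_le {T : H →L[ℂ] H}
    (hT : T.IsPositive) {S : K →L[ℂ] K} (h : ∀ z : ℂ, ‖S - z • 1‖ ≤ ‖T - z • 1‖) :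
    S.IsPositive := by
  rw [ContinuousLinearMap.isPositive_iff_complex]
  intro x
  -- Each `z` confines `⟨Sx, x⟩` to a disk. Disks with far imaginary centres force it to be real;
  -- the disk centred at `‖T‖‖x‖²` then forces it to be nonnegative.
  have hz : ∀ z : ℂ, ‖inner ℂ (S x) x - conj z * ((‖x‖ ^ 2 : ℝ) : ℂ)‖ ≤
      ‖T - z • 1‖ * ‖x‖ ^ 2 := by
    intro z
    have h1 : inner ℂ (S x) x - conj z * ((‖x‖ ^ 2 : ℝ) : ℂ) = inner ℂ ((S - z • 1) x) x := by
      have h3 : (S - z • 1) x = S x - z • x := rfl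
      rw [h3, inner_sub_left, inner_smul_left, inner_self_eq_norm_sq_to_K]
      simp
    rw [h1]
    calc _ ≤ ‖(S - z • 1) x‖ * ‖x‖ := norm_inner_le_norm _ _
      _ ≤ ‖T - z • 1‖ * ‖x‖ * ‖x‖ := by
        gcongr
        exact (S - z • 1).le_of_opNorm_le (h z) x
      _ = _ := by ring
  set w := inner ℂ (S x) x with hw
  have him : w.im = 0 := by
    by_contra hne
    have hx : x ≠ 0 := by
      rintro rfl
      exact hne (by simp [hw])
    have hm : 0 < ‖x‖ ^ 2 := by positivity
    set m := ‖x‖ ^ 2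
    have key : ∀ s : ℝ, (w.im + s * m) ^ 2 ≤ (‖T‖ ^ 2 + s ^ 2) * m ^ 2 := by
      intro s
      have h1 := (Complex.abs_im_le_norm _).trans (hz (s * Complex.I))
      have h2 : (w - conj (s * Complex.I : ℂ) * (m : ℂ)).im = w.im + s * m := by simp
      rw [h2] at h1
      have h3 := hT.norm_sub_I_smul_one_sq_le s
      calc (w.im + s * m) ^ 2 = |w.im + s * m| ^ 2 := (sq_abs _).symm
        _ ≤ (‖T - (s * Complex.I : ℂ) • 1‖ * m) ^ 2 := by gcongr
        _ = ‖T - (s * Complex.I : ℂ) • 1‖ ^ 2 * m ^ 2 := by ring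
        _ ≤ _ := by gcongr
    -- In `key` the terms `s²m²` cancel, leaving a bound on `2sm·w.im`; this `s` makes that product
    -- exceed the bound by one.
    have h1 := key ((‖T‖ ^ 2 * m ^ 2 + 1) / (2 * m * w.im))
    have h2 : (‖T‖ ^ 2 * m ^ 2 + 1) / (2 * m * w.im) * (2 * m * w.im) = ‖T‖ ^ 2 * m ^ 2 + 1 :=
      div_mul_cancel₀ _ (mul_ne_zero (by positivity) hne)
    nlinarith [sq_nonneg w.im]
  refine ⟨Complex.ext rfl (by simp [him]), ?_⟩
  have h1 := hz ‖T‖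
  have h2 := (Complex.abs_re_le_norm _).trans h1
  have h3 := hT.norm_sub_norm_smul_one_le
  have h4 : (w - conj (‖T‖ : ℂ) * ((‖x‖ ^ 2 : ℝ) : ℂ)).re = w.re - ‖T‖ * ‖x‖ ^ 2 := by
    rw [Complex.conj_ofReal, ← Complex.ofReal_mul, Complex.sub_re, Complex.ofReal_re]
  rw [h4] at h2
  have h5 : ‖T - (‖T‖ : ℂ) • 1‖ * ‖x‖ ^ 2 ≤ ‖T‖ * ‖x‖ ^ 2 := by gcongr
  have h6 := neg_le_of_abs_le (h2.trans h5)
  change 0 ≤ w.re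
  linarith

end NumericalRange

/-! ### Unital maps of operator systems: adjoints, contractivity, inverses. -/

section OperatorSystems

variable {H K : Type*} [NormedAddCommGroup H] [InnerProductSpace ℂ H] [CompleteSpace H]
  [NormedAddCommGroup K] [InnerProductSpace ℂ K] [CompleteSpace K] {d n : ℕ}
  {A : Fin d → H →L[ℂ] H} {B : Fin d → K →L[ℂ] K}
  {φ : operatorSystem A →ₗ[ℂ] operatorSystem B}

theorem star_mem_operatorSystem {T : H →L[ℂ] H} (hT : T ∈ operatorSystem A) :
    star T ∈ operatorSystem A := by
  induction hT using Submodule.span_induction with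
  | mem T hT =>
    rcases hT with (hT | ⟨i, rfl⟩) | ⟨i, rfl⟩
    · rw [Set.mem_singleton_iff.mp hT, star_one]
      exact one_mem_operatorSystem A
    · exact Submodule.subset_span (Or.inr ⟨i, rfl⟩)
    · change star (star (A i)) ∈ operatorSystem A
      rw [star_star]
      exact mem_operatorSystem A i
  | zero => rw [star_zero]; exact zero_mem _
  | add S T _ _ hS hT => rw [star_add]; exact add_mem hS hT
  | smul c T _ hT => rw [star_smul]; exact Submodule.smul_mem _ _ hT

/-- The unit of the operator system of `A`. -/
def operatorSystemOne (A : Fin d → H →L[ℂ] H) : operatorSystem A :=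
  ⟨1, one_mem_operatorSystem A⟩

/-- The adjoint on the operator system of `A`. -/
noncomputable def operatorSystemStar (s : operatorSystem A) : operatorSystem A :=
  ⟨star (s : H →L[ℂ] H), star_mem_operatorSystem s.2⟩

theorem IsNPositive.map_isPositive (hn : n ≠ 0) (hφ : IsNPositive n φ) (s : operatorSystem A)
    (hs : (s : H →L[ℂ] H).IsPositive) : (φ s : K →L[ℂ] K).IsPositive := by
  have h1 := hφ (Matrix.of fun i j => (1 : Matrix (Fin n) (Fin n) ℂ) i j • s)
    ((isPositive_blockOp_scalar_iff hn _).mpr hs)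
  have h2 : ((Matrix.of fun i j => (1 : Matrix (Fin n) (Fin n) ℂ) i j • s).map
      fun s => (φ s : K →L[ℂ] K)) = tensorMatrix 1 (φ s : K →L[ℂ] K) := by
    ext1 i j
    simp [tensorMatrix_apply]
  rw [h2] at h1
  exact (isPositive_blockOp_scalar_iff hn _).mp h1

/-- A self-adjoint `s` becomes positive after adding `‖s‖`, so its image is self-adjoint. Applying
this to `s + s*` and `i(s - s*)` handles a general `s`. -/
theorem IsNPositive.map_star (hn : n ≠ 0) (hφ : IsNPositive n φ)
    (hφ1 : φ (operatorSystemOne A) = operatorSystemOne B) (s : operatorSystem A) :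
    φ (operatorSystemStar s) = operatorSystemStar (φ s) := by
  have hsa : ∀ s : operatorSystem A, IsSelfAdjoint (s : H →L[ℂ] H) →
      IsSelfAdjoint (φ s : K →L[ℂ] K) := by
    intro s hs
    have h1 := (hφ.map_isPositive hn (s + (‖(s : H →L[ℂ] H)‖ : ℂ) • operatorSystemOne A)
      hs.isPositive_add_norm_smul_one).isSelfAdjoint
    rw [map_add, map_smul, hφ1] at h1
    have h2 : IsSelfAdjoint ((‖(s : H →L[ℂ] H)‖ : ℂ) • (1 : K →L[ℂ] K)) :=
      (isPositive_ofReal_smul_one (norm_nonneg _)).isSelfAdjoint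
    have h3 := h1.sub h2
    have h4 : (φ s + (‖(s : H →L[ℂ] H)‖ : ℂ) • operatorSystemOne B : operatorSystem B) -
        (‖(s : H →L[ℂ] H)‖ : ℂ) • (1 : K →L[ℂ] K) = (φ s : K →L[ℂ] K) :=
      add_sub_cancel_right _ _
    rwa [h4] at h3
  have hadd := hsa (s + operatorSystemStar s) (IsSelfAdjoint.add_star_self (s : H →L[ℂ] H))
  have hsub := hsa (Complex.I • (s - operatorSystemStar s)) (by
    change star (Complex.I • ((s : H →L[ℂ] H) - star (s : H →L[ℂ] H))) =
      Complex.I • ((s : H →L[ℂ] H) - star (s : H →L[ℂ] H))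
    simp [star_smul, smul_sub]
    abel)
  have e1 : star ((φ s : K →L[ℂ] K) + φ (operatorSystemStar s)) =
      (φ s : K →L[ℂ] K) + φ (operatorSystemStar s) := by
    simpa using hadd.star_eq
  have e2 : star (Complex.I • ((φ s : K →L[ℂ] K) - φ (operatorSystemStar s))) =
      Complex.I • ((φ s : K →L[ℂ] K) - φ (operatorSystemStar s)) := by
    simpa using hsub.star_eq
  ext1
  change (φ (operatorSystemStar s) : K →L[ℂ] K) = star (φ s : K →L[ℂ] K)
  rw [star_smul, Complex.star_def, Complex.conj_I, neg_smul, ← smul_neg] at e2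
  have e3 := smul_right_injective (K →L[ℂ] K) Complex.I_ne_zero e2
  simp only [star_sub, star_add] at e1 e3
  set a := star (φ s : K →L[ℂ] K)
  set b := star (φ (operatorSystemStar s) : K →L[ℂ] K)
  set u := (φ s : K →L[ℂ] K)
  set v := (φ (operatorSystemStar s) : K →L[ℂ] K)
  have e4 : (2 : ℂ) • a = (2 : ℂ) • v := by
    rw [two_smul, two_smul]
    calc a + a = (a + b) - (-(a - b)) := by abel
      _ = _ := by rw [e1, e3]; abel
  exact (smul_right_injective (K →L[ℂ] K) (two_ne_zero (α := ℂ)) e4).symm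

/-- Unital completely positive maps are completely contractive. -/
theorem IsCompletelyPositive.norm_blockOp_map_le (hφ : IsCompletelyPositive φ)
    (hφ1 : φ (operatorSystemOne A) = operatorSystemOne B)
    (M : Matrix (Fin n) (Fin n) (operatorSystem A)) :
    ‖blockOp (M.map fun s => (φ s : K →L[ℂ] K))‖ ≤
      ‖blockOp (M.map fun s => (s : H →L[ℂ] H))‖ := by
  -- Taking `r` strictly above the norm ensures `r > 0`, even when the matrix is zero.
  refine le_of_forall_gt_imp_ge_of_dense fun r hr => ?_
  have hr0 : 0 < r := (norm_nonneg _).trans_lt hr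
  refine norm_le_of_isPositive_normBlock hr0 ?_
  have h1 := isPositive_normBlock hr.le
  set D : Matrix (Fin n) (Fin n) (operatorSystem A) :=
    Matrix.of fun i j => ((r : ℂ) • (1 : Matrix (Fin n) (Fin n) ℂ)) i j • operatorSystemOne A
    with hD
  set W : Matrix (Fin (n + n)) (Fin (n + n)) (operatorSystem A) :=
    (Matrix.fromBlocks D M (Matrix.of fun i j => operatorSystemStar (M j i)) D).submatrix
      finSumFinEquiv.symm finSumFinEquiv.symm with hW
  have hDA : D.map (fun s => (s : H →L[ℂ] H)) = (r : ℂ) • 1 := by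
    rw [← tensorMatrix_one, ← tensorMatrix_smul_left]
    rfl
  have hWA : W.map (fun s => (s : H →L[ℂ] H)) =
      normBlock (r : ℂ) (M.map fun s => (s : H →L[ℂ] H)) := by
    rw [hW, normBlock, ← Matrix.submatrix_map, Matrix.fromBlocks_map, hDA]
    rfl
  have hWB : W.map (fun s => (φ s : K →L[ℂ] K)) =
      normBlock (r : ℂ) (M.map fun s => (φ s : K →L[ℂ] K)) := by
    have hDB : D.map (fun s => (φ s : K →L[ℂ] K)) = (r : ℂ) • 1 := by
      ext1 i j
      rw [← tensorMatrix_one, ← tensorMatrix_smul_left]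
      simp only [hD, Matrix.map_apply, Matrix.of_apply, map_smul, hφ1]
      rfl
    rw [hW, normBlock, ← Matrix.submatrix_map, Matrix.fromBlocks_map, hDB]
    congr 2
    ext1 i j
    change (φ (operatorSystemStar (M j i)) : K →L[ℂ] K) = star (φ (M j i) : K →L[ℂ] K)
    rw [(hφ 1).map_star one_ne_zero hφ1]
    rfl
  rw [← hWB]
  rw [← hWA] at h1
  exact hφ _ W h1

theorem IsCompletelyIsometric.isCompletelyPositive (hφ : IsCompletelyIsometric φ)
    (hφ1 : φ (operatorSystemOne A) = operatorSystemOne B) : IsCompletelyPositive φ := by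
  intro n M hM
  -- As `φ` is unital, subtracting `z` from a matrix commutes with the amplification, so the
  -- isometry applies to every translate.
  refine hM.of_norm_sub_smul_one_le fun z => le_of_eq ?_
  have h := hφ n (M - Matrix.of fun i j => (z • (1 : Matrix (Fin n) (Fin n) ℂ)) i j •
    operatorSystemOne A)
  have hA : ((M - Matrix.of fun i j => (z • (1 : Matrix (Fin n) (Fin n) ℂ)) i j •
      operatorSystemOne A).map fun s => (s : H →L[ℂ] H)) =
      M.map (fun s => (s : H →L[ℂ] H)) - z • 1 := by
    rw [← tensorMatrix_one, ← tensorMatrix_smul_left]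
    rfl
  have hB : ((M - Matrix.of fun i j => (z • (1 : Matrix (Fin n) (Fin n) ℂ)) i j •
      operatorSystemOne A).map fun s => (φ s : K →L[ℂ] K)) =
      M.map (fun s => (φ s : K →L[ℂ] K)) - z • 1 := by
    rw [← tensorMatrix_one, ← tensorMatrix_smul_left]
    ext1 i j
    simp only [Matrix.map_apply, Matrix.sub_apply, Matrix.of_apply, map_sub, map_smul, hφ1]
    rfl
  rw [hA, hB, blockOp_sub, blockOp_sub, blockOp_smul, blockOp_smul, blockOp_one, blockOp_one] at h
  exact h

theorem IsUnitalInterpolating.map_one (hφ : IsUnitalInterpolating A B φ) :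
    φ (operatorSystemOne A) = operatorSystemOne B := hφ.1

theorem IsUnitalInterpolating.map_generator_star (hφ : IsUnitalInterpolating A B φ) (hn : n ≠ 0)
    (hpos : IsNPositive n φ) (i : Fin d) :
    φ (operatorSystemStar ⟨A i, mem_operatorSystem A i⟩) =
      operatorSystemStar ⟨B i, mem_operatorSystem B i⟩ := by
  rw [hpos.map_star hn hφ.map_one, hφ.2 i]

theorem operatorSystem_linearMap_ext {V : Type*} [AddCommGroup V] [Module ℂ V]
    {f g : operatorSystem A →ₗ[ℂ] V} (h1 : f (operatorSystemOne A) = g (operatorSystemOne A))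
    (hA : ∀ i, f ⟨A i, mem_operatorSystem A i⟩ = g ⟨A i, mem_operatorSystem A i⟩)
    (hA' : ∀ i, f (operatorSystemStar ⟨A i, mem_operatorSystem A i⟩) =
      g (operatorSystemStar ⟨A i, mem_operatorSystem A i⟩)) : f = g := by
  ext ⟨s, hs⟩
  induction hs using Submodule.span_induction with
  | mem T hT =>
    rcases hT with (hT | ⟨i, rfl⟩) | ⟨i, rfl⟩
    · obtain rfl := Set.mem_singleton_iff.mp hT
      exact h1
    · exact hA i
    · exact hA' i
  | zero => exact (map_zero f).trans (map_zero g).symm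
  | add S T hS hT h h' =>
    have e : (⟨S + T, add_mem hS hT⟩ : operatorSystem A) = ⟨S, hS⟩ + ⟨T, hT⟩ := rfl
    exact (congrArg f e).trans (by rw [map_add, h, h', ← map_add]; rfl)
  | smul c T hT h =>
    have e : (⟨c • T, Submodule.smul_mem _ c hT⟩ : operatorSystem A) = c • ⟨T, hT⟩ := rfl
    exact (congrArg f e).trans (by rw [map_smul, h, ← map_smul]; rfl)

theorem isCompletelyIsometric_of_inverse {ψ : operatorSystem B →ₗ[ℂ] operatorSystem A}
    (hφ : IsUnitalInterpolating A B φ) (hφp : IsCompletelyPositive φ)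
    (hψ : IsUnitalInterpolating B A ψ) (hψp : IsCompletelyPositive ψ) :
    IsCompletelyIsometric φ := by
  have hinv : ψ ∘ₗ φ = LinearMap.id := by
    refine operatorSystem_linearMap_ext ?_ (fun i => ?_) fun i => ?_
    · rw [LinearMap.comp_apply, hφ.map_one, hψ.map_one, LinearMap.id_apply]
    · rw [LinearMap.comp_apply, hφ.2, hψ.2, LinearMap.id_apply]
    · rw [LinearMap.comp_apply, hφ.map_generator_star one_ne_zero (hφp 1),
        hψ.map_generator_star one_ne_zero (hψp 1), LinearMap.id_apply]
  intro n M
  refine le_antisymm (hφp.norm_blockOp_map_le hφ.map_one M) ?_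
  have h := hψp.norm_blockOp_map_le hψ.map_one (M.map φ)
  have e : (M.map φ).map (fun s => (ψ s : H →L[ℂ] H)) = M.map fun s => (s : H →L[ℂ] H) := by
    ext1 i j
    exact congrArg Subtype.val (LinearMap.congr_fun hinv (M i j))
  rw [e] at h
  exact h

/-- Isometry on `1 × 1` matrices gives injectivity. The range contains all generators, with `star (B
i)` reached because `φ` preserves adjoints. -/
theorem IsCompletelyIsometric.exists_inverse (hφi : IsCompletelyIsometric φ)
    (hφ : IsUnitalInterpolating A B φ) :
    ∃ ψ : operatorSystem B →ₗ[ℂ] operatorSystem A,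
      IsUnitalInterpolating B A ψ ∧ IsCompletelyPositive ψ := by
  have hφp := hφi.isCompletelyPositive hφ.map_one
  have hinj : Function.Injective φ := by
    rw [← LinearMap.ker_eq_bot, LinearMap.ker_eq_bot']
    intro s hs
    have h1 := hφi 1 (Matrix.of fun _ _ => s)
    have h2 : ((Matrix.of fun _ _ : Fin 1 => s).map fun s => (φ s : K →L[ℂ] K)) = 0 := by
      ext1 i j
      simp [hs]
    rw [h2, blockOp_zero, norm_zero, eq_comm, norm_eq_zero, ← blockOp_zero] at h1
    exact Subtype.ext (congrFun (congrFun (blockOp_injective h1) 0) 0)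
  have hsurj : Function.Surjective φ := by
    rw [← LinearMap.range_eq_top, eq_top_iff]
    have hle : operatorSystem B ≤ (LinearMap.range φ).map (operatorSystem B).subtype := by
      refine Submodule.span_le.mpr ?_
      rintro T ((hT | ⟨i, rfl⟩) | ⟨i, rfl⟩)
      · obtain rfl := Set.mem_singleton_iff.mp hT
        exact ⟨_, ⟨_, hφ.map_one⟩, rfl⟩
      · exact ⟨_, ⟨_, hφ.2 i⟩, rfl⟩
      · exact ⟨_, ⟨_, hφ.map_generator_star one_ne_zero (hφp 1) i⟩, rfl⟩
    rintro ⟨T, hT⟩ -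
    obtain ⟨y, hy, rfl⟩ := hle hT
    exact hy
  set e := LinearEquiv.ofBijective φ ⟨hinj, hsurj⟩
  have he : ∀ t, φ (e.symm t) = t := e.apply_symm_apply
  have hψ : IsUnitalInterpolating B A (e.symm : operatorSystem B →ₗ[ℂ] operatorSystem A) :=
    ⟨hinj ((he _).trans hφ.map_one.symm), fun i => hinj ((he _).trans (hφ.2 i).symm)⟩
  refine ⟨e.symm, hψ, IsCompletelyIsometric.isCompletelyPositive (fun n M => ?_) hψ.map_one⟩
  have h := hφi n (M.map e.symm)
  have hM : (M.map e.symm).map (fun s => (φ s : K →L[ℂ] K)) = M.map fun s => (s : K →L[ℂ] K) := by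
    ext1 i j
    exact congrArg Subtype.val (he (M i j))
  rw [hM] at h
  exact h.symm

end OperatorSystems

/-! ### Free spectrahedra: from maps to inclusions and back. -/

section Spectrahedra

section

variable {H : Type*} [NormedAddCommGroup H] [InnerProductSpace ℂ H] {d n : ℕ}
  {A : Fin d → H →L[ℂ] H}

theorem mem_saFreeSpectrahedron_iff {X : Fin d → Matrix (Fin n) (Fin n) ℂ} :
    X ∈ saFreeSpectrahedron A n ↔ (∀ k, (X k).IsHermitian) ∧
      (blockOp (1 - ∑ k, tensorMatrix (X k) (A k))).IsPositive := by
  rw [← linearPencil_eq]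
  rfl

theorem isPositive_of_fin_zero (T : PiLp 2 (fun _ : Fin 0 => H) →L[ℂ] PiLp 2 (fun _ : Fin 0 => H)) :
    T.IsPositive := by
  have h : T = 0 := by
    ext x i
    exact i.elim0
  rw [h]
  exact ContinuousLinearMap.isPositive_zero

/-- At scalar matrices `t c k` the pencil is `(1 + t(-∑ c k G k)) ⊗ 1`, so such a `c` spans a ray
inside the spectrahedron. -/
theorem isPositive_blockOp_one_sub_sum_smul {ι : Type*} [Fintype ι] {G : ι → H →L[ℂ] H}
    {c : ι → ℝ} (hc : (-∑ k, (c k : ℂ) • G k).IsPositive) {t : ℝ} (ht : 0 ≤ t) :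
    (blockOp (1 - ∑ k, tensorMatrix (((t : ℂ) * (c k : ℂ)) • (1 : Matrix (Fin n) (Fin n) ℂ))
      (G k))).IsPositive := by
  have h1 : (1 - ∑ k, tensorMatrix (((t : ℂ) * (c k : ℂ)) • (1 : Matrix (Fin n) (Fin n) ℂ))
      (G k)) = tensorMatrix 1 (1 + (t : ℂ) • -∑ k, (c k : ℂ) • G k) := by
    rw [← tensorMatrix_one]
    ext1 i j
    simp only [Matrix.sub_apply, Matrix.sum_apply, tensorMatrix_apply, Matrix.smul_apply,
      smul_neg, smul_sub, Finset.smul_sum, smul_smul, smul_eq_mul, ← sub_eq_add_neg]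
    congr 1
    exact Finset.sum_congr rfl fun k _ => by rw [mul_comm]
  rw [h1]
  rcases eq_or_ne n 0 with rfl | hn
  · exact isPositive_of_fin_zero _
  exact (isPositive_blockOp_scalar_iff hn _).mpr
    (ContinuousLinearMap.isPositive_one.add (hc.smul_of_nonneg (by simpa using ht)))

end

variable {H K : Type*} [NormedAddCommGroup H] [InnerProductSpace ℂ H] [CompleteSpace H]
  [NormedAddCommGroup K] [InnerProductSpace ℂ K] [CompleteSpace K] {d n : ℕ}
  {A : Fin d → H →L[ℂ] H} {B : Fin d → K →L[ℂ] K}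

theorem realPart_linearPencil (A : Fin d → H →L[ℂ] H) (X : Fin d → Matrix (Fin n) (Fin n) ℂ) :
    ((realPart (linearPencil A X) : selfAdjoint _) :
      PiLp 2 (fun _ : Fin n => H) →L[ℂ] PiLp 2 (fun _ : Fin n => H)) =
    blockOp (1 - ∑ k, (2⁻¹ : ℂ) • (tensorMatrix (X k) (A k) +
      tensorMatrix (star (X k)) (star (A k)))) := by
  have h1 : ∀ T : PiLp 2 (fun _ : Fin n => H) →L[ℂ] PiLp 2 (fun _ : Fin n => H),
      (2⁻¹ : ℝ) • T = (2⁻¹ : ℂ) • T := by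
    intro T
    refine (Complex.coe_smul (2⁻¹ : ℝ) T).symm.trans ?_
    rw [Complex.ofReal_inv, Complex.ofReal_ofNat]
  rw [realPart_apply_coe, linearPencil_eq, ← blockOp_star, ← blockOp_add, h1, ← blockOp_smul]
  congr 1
  simp only [star_sub, star_one, star_sum, tensorMatrix_star, smul_add, Finset.sum_add_distrib,
    ← Finset.smul_sum]
  module

theorem mem_freeSpectrahedron_iff {X : Fin d → Matrix (Fin n) (Fin n) ℂ} :
    X ∈ freeSpectrahedron A n ↔ (blockOp (1 - ∑ k, (2⁻¹ : ℂ) • (tensorMatrix (X k) (A k) +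
      tensorMatrix (star (X k)) (star (A k))))).IsPositive := by
  rw [← realPart_linearPencil]
  rfl

theorem IsNPositive.freeSpectrahedron_subset {φ : operatorSystem A →ₗ[ℂ] operatorSystem B}
    (hφ : IsUnitalInterpolating A B φ) (hpos : IsNPositive n φ) :
    freeSpectrahedron A n ⊆ freeSpectrahedron B n := by
  intro X hX
  rw [mem_freeSpectrahedron_iff] at hX ⊢
  -- `0`-positivity is vacuous and does not control adjoints, so this level is settled separately.
  rcases eq_or_ne n 0 with rfl | hn
  · exact isPositive_of_fin_zero _
  set M : Matrix (Fin n) (Fin n) (operatorSystem A) := Matrix.of fun i j =>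
    (1 : Matrix (Fin n) (Fin n) ℂ) i j • operatorSystemOne A -
      ∑ k, (2⁻¹ : ℂ) • (X k i j • (⟨A k, mem_operatorSystem A k⟩ : operatorSystem A) +
        star (X k) i j • operatorSystemStar ⟨A k, mem_operatorSystem A k⟩) with hM
  have hA : M.map (fun s => (s : H →L[ℂ] H)) = 1 - ∑ k, (2⁻¹ : ℂ) •
      (tensorMatrix (X k) (A k) + tensorMatrix (star (X k)) (star (A k))) := by
    rw [← tensorMatrix_one]
    ext1 i j
    simp only [hM, Matrix.map_apply, Matrix.of_apply, Matrix.sub_apply, Matrix.sum_apply,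
      Matrix.smul_apply, Matrix.add_apply, tensorMatrix_apply, Submodule.coe_sub,
      Submodule.coe_sum, Submodule.coe_smul, Submodule.coe_add]
    rfl
  have hB : M.map (fun s => (φ s : K →L[ℂ] K)) = 1 - ∑ k, (2⁻¹ : ℂ) •
      (tensorMatrix (X k) (B k) + tensorMatrix (star (X k)) (star (B k))) := by
    rw [← tensorMatrix_one]
    ext1 i j
    simp only [hM, Matrix.map_apply, Matrix.of_apply, Matrix.sub_apply, Matrix.sum_apply,
      Matrix.smul_apply, Matrix.add_apply, tensorMatrix_apply, map_sub, map_sum, map_smul, map_add,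
      hφ.map_one, hφ.2, hφ.map_generator_star hn hpos, Submodule.coe_sub,
      Submodule.coe_sum, Submodule.coe_smul, Submodule.coe_add]
    rfl
  rw [← hA] at hX
  rw [← hB]
  exact hpos M hX

theorem IsNPositive.saFreeSpectrahedron_subset {φ : operatorSystem A →ₗ[ℂ] operatorSystem B}
    (hφ : IsUnitalInterpolating A B φ) (hpos : IsNPositive n φ) :
    saFreeSpectrahedron A n ⊆ saFreeSpectrahedron B n := by
  intro X hX
  rw [mem_saFreeSpectrahedron_iff] at hX ⊢
  refine ⟨hX.1, ?_⟩
  set M : Matrix (Fin n) (Fin n) (operatorSystem A) := Matrix.of fun i j =>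
    (1 : Matrix (Fin n) (Fin n) ℂ) i j • operatorSystemOne A -
      ∑ k, X k i j • (⟨A k, mem_operatorSystem A k⟩ : operatorSystem A) with hM
  have hA : M.map (fun s => (s : H →L[ℂ] H)) = 1 - ∑ k, tensorMatrix (X k) (A k) := by
    rw [← tensorMatrix_one]
    ext1 i j
    simp only [hM, Matrix.map_apply, Matrix.of_apply, Matrix.sub_apply, Matrix.sum_apply,
      tensorMatrix_apply, Submodule.coe_sub, Submodule.coe_sum, Submodule.coe_smul]
    rfl
  have hB : M.map (fun s => (φ s : K →L[ℂ] K)) = 1 - ∑ k, tensorMatrix (X k) (B k) := by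
    rw [← tensorMatrix_one]
    ext1 i j
    simp only [hM, Matrix.map_apply, Matrix.of_apply, Matrix.sub_apply, Matrix.sum_apply,
      tensorMatrix_apply, map_sub, map_sum, map_smul, hφ.map_one, hφ.2, Submodule.coe_sub,
      Submodule.coe_sum, Submodule.coe_smul]
    rfl
  have h := hX.2
  rw [← hA] at h
  rw [← hB]
  exact hpos M h

/-- A completely positive interpolating map exists as soon as the operator systems are spanned
by self-adjoint families `G`, `F` whose pencils satisfy the inclusion of free spectrahedra. -/
theorem exists_isCompletelyPositive_of_subset {ι : Type*} [Fintype ι] [Nonempty ι]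
    {G : ι → H →L[ℂ] H} {F : ι → K →L[ℂ] K} (hG : ∀ k, IsSelfAdjoint (G k))
    (hb : ∀ c : ι → ℝ, (-∑ k, (c k : ℂ) • G k).IsPositive → c = 0)
    (hGF : ∀ (n : ℕ) (X : ι → Matrix (Fin n) (Fin n) ℂ), (∀ k, (X k).IsHermitian) →
      (blockOp (1 - ∑ k, tensorMatrix (X k) (G k))).IsPositive →
      (blockOp (1 - ∑ k, tensorMatrix (X k) (F k))).IsPositive)
    (hspan : operatorSystem A ≤ Submodule.span ℂ (insert 1 (Set.range G)))
    (hAB : ∀ f : (H →L[ℂ] H) →ₗ[ℂ] (K →L[ℂ] K), (∀ k, f (G k) = F k) →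
      ∀ i, f (A i) = B i ∧ f (star (A i)) = star (B i)) :
    ∃ φ : operatorSystem A →ₗ[ℂ] operatorSystem B,
      IsUnitalInterpolating A B φ ∧ IsCompletelyPositive φ := by
  have := nontrivial_of_forall_isPositive_neg_sum hb
  have hv := linearIndependent_one_of_bounded hG hb
  obtain ⟨f, hf⟩ := exists_linearMap_of_linearIndependent hv (fun o : Option ι => o.elim (1 : K →L[ℂ] K) F)
  have f_one : f 1 = 1 := hf none
  have f_G : ∀ k, f (G k) = F k := fun k => hf (some k)
  have hmaps : ∀ s ∈ operatorSystem A, f s ∈ operatorSystem B := by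
    have hle : operatorSystem A ≤ (operatorSystem B).comap f := by
      refine Submodule.span_le.mpr ?_
      rintro T ((hT | ⟨i, rfl⟩) | ⟨i, rfl⟩)
      · obtain rfl := Set.mem_singleton_iff.mp hT
        change f 1 ∈ operatorSystem B
        rw [f_one]
        exact one_mem_operatorSystem B
      · change f (A i) ∈ operatorSystem B
        rw [(hAB f f_G i).1]
        exact mem_operatorSystem B i
      · change f (star (A i)) ∈ operatorSystem B
        rw [(hAB f f_G i).2]
        exact star_mem_operatorSystem (mem_operatorSystem B i)
    exact hle
  refine ⟨f.restrict hmaps, ⟨Subtype.ext f_one, fun i => Subtype.ext (hAB f f_G i).1⟩, ?_⟩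
  intro n M hM
  exact isPositive_blockOp_map_of_subset hG hb (hGF n) f f_one f_G _
    (fun i j => hspan (M i j).2) hM

theorem FreeSet.IsBounded.eq_zero {S : FreeSet d} (hS : S.IsBounded) {c : Fin d → ℂ}
    (hc : ∀ t : ℝ, 0 ≤ t →
      (fun k => ((t : ℂ) * c k) • (1 : Matrix (Fin 1) (Fin 1) ℂ)) ∈ S 1) : c = 0 := by
  obtain ⟨R, hR⟩ := hS
  ext k
  by_contra hk
  have hk' : 0 < ‖c k‖ := norm_pos_iff.mpr hk
  -- At this `t` the `k`-th coordinate has norm `|R| + 1`, which exceeds `R`.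
  have h1 := hR 1 _ (hc ((|R| + 1) / ‖c k‖) (by positivity)) k
  rw [map_smul, map_one, norm_smul, norm_one, mul_one, norm_mul, Complex.norm_real,
    Real.norm_of_nonneg (by positivity), div_mul_cancel₀ _ hk'.ne'] at h1
  linarith [le_abs_self R]

theorem exists_isCompletelyPositive_of_saFreeSpectrahedron_subset (hd : 1 ≤ d)
    (hA : ∀ i, IsSelfAdjoint (A i)) (hB : ∀ i, IsSelfAdjoint (B i))
    (hbd : (saFreeSpectrahedron A).IsBounded)
    (hAB : ∀ n, saFreeSpectrahedron A n ⊆ saFreeSpectrahedron B n) :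
    ∃ φ : operatorSystem A →ₗ[ℂ] operatorSystem B,
      IsUnitalInterpolating A B φ ∧ IsCompletelyPositive φ := by
  have : Nonempty (Fin d) := ⟨⟨0, hd⟩⟩
  refine exists_isCompletelyPositive_of_subset (G := A) (F := B) hA (fun c hc => ?_)
    (fun n X hX h => ?_) ?_ (fun f hf i => ?_)
  · have h := hbd.eq_zero (c := fun k => (c k : ℂ)) fun t ht => by
      refine mem_saFreeSpectrahedron_iff.mpr ⟨fun k => ?_, isPositive_blockOp_one_sub_sum_smul hc ht⟩
      rw [Matrix.IsHermitian, Matrix.conjTranspose_smul, Matrix.conjTranspose_one]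
      simp
    ext k
    simpa using congrFun h k
  · exact (mem_saFreeSpectrahedron_iff.mp (hAB n (mem_saFreeSpectrahedron_iff.mpr ⟨hX, h⟩))).2
  · refine Submodule.span_le.mpr ?_
    rintro T ((hT | ⟨i, rfl⟩) | ⟨i, rfl⟩)
    · exact Submodule.subset_span (Or.inl hT)
    · exact Submodule.subset_span (Or.inr ⟨i, rfl⟩)
    · exact Submodule.subset_span (Or.inr ⟨i, (hA i).star_eq.symm⟩)
  · rw [(hA i).star_eq, (hB i).star_eq]
    exact ⟨hf i, hf i⟩

/-- The self-adjoint family of the real and imaginary parts of a tuple of operators. -/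
noncomputable def realImagParts (A : Fin d → H →L[ℂ] H) : Fin d ⊕ Fin d → H →L[ℂ] H :=
  Sum.elim (fun k => (realPart (A k) : H →L[ℂ] H)) fun k => (imaginaryPart (A k) : H →L[ℂ] H)

theorem eq_realImagParts (A : Fin d → H →L[ℂ] H) (k : Fin d) :
    A k = realImagParts A (.inl k) + Complex.I • realImagParts A (.inr k) :=
  (realPart_add_I_smul_imaginaryPart (A k)).symm

theorem isSelfAdjoint_realImagParts (A : Fin d → H →L[ℂ] H) (k : Fin d ⊕ Fin d) :
    IsSelfAdjoint (realImagParts A k) := by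
  rcases k with k | k
  · exact (realPart (A k)).2
  · exact (imaginaryPart (A k)).2

theorem star_eq_realImagParts (A : Fin d → H →L[ℂ] H) (k : Fin d) :
    star (A k) = realImagParts A (.inl k) - Complex.I • realImagParts A (.inr k) := by
  conv_lhs => rw [eq_realImagParts A k]
  rw [star_add, star_smul, (isSelfAdjoint_realImagParts A _).star_eq,
    (isSelfAdjoint_realImagParts A _).star_eq, Complex.star_def, Complex.conj_I, neg_smul,
    sub_eq_add_neg]

/-- For `A = P + iQ` the real part of `A ⊗ (Y - iZ)` is `P ⊗ Y + Q ⊗ Z`, the minus sign absorbing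
`i² = -1`. This reduces the general case to a self-adjoint pencil in `2d` variables. -/
theorem sub_I_smul_mem_freeSpectrahedron_iff {X : Fin d ⊕ Fin d → Matrix (Fin n) (Fin n) ℂ}
    (hX : ∀ k, (X k).IsHermitian) :
    (fun k => X (.inl k) - Complex.I • X (.inr k)) ∈ freeSpectrahedron A n ↔
      (blockOp (1 - ∑ k, tensorMatrix (X k) (realImagParts A k))).IsPositive := by
  rw [mem_freeSpectrahedron_iff, Fintype.sum_sum_type, ← Finset.sum_add_distrib]
  have h : ∀ k, (2⁻¹ : ℂ) • (tensorMatrix (X (.inl k) - Complex.I • X (.inr k)) (A k) +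
      tensorMatrix (star (X (.inl k) - Complex.I • X (.inr k))) (star (A k))) =
      tensorMatrix (X (.inl k)) (realImagParts A (.inl k)) +
        tensorMatrix (X (.inr k)) (realImagParts A (.inr k)) := by
    intro k
    have h1 : star (X (.inl k)) = X (.inl k) := hX _
    have h2 : star (X (.inr k)) = X (.inr k) := hX _
    rw [star_sub, star_smul, h1, h2, star_eq_realImagParts, Complex.star_def, Complex.conj_I]
    rw [eq_realImagParts A k]
    ext1 i j
    simp only [Matrix.smul_apply, Matrix.add_apply, Matrix.sub_apply, tensorMatrix_apply,
      smul_eq_mul]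
    match_scalars
    · ring
    · linear_combination (-(X (.inr k) i j)) * Complex.I_sq
  simp only [h]

theorem exists_isCompletelyPositive_of_freeSpectrahedron_subset (hd : 1 ≤ d)
    (hbd : (freeSpectrahedron A).IsBounded)
    (hAB : ∀ n, freeSpectrahedron A n ⊆ freeSpectrahedron B n) :
    ∃ φ : operatorSystem A →ₗ[ℂ] operatorSystem B,
      IsUnitalInterpolating A B φ ∧ IsCompletelyPositive φ := by
  have : Nonempty (Fin d) := ⟨⟨0, hd⟩⟩
  refine exists_isCompletelyPositive_of_subset (G := realImagParts A) (F := realImagParts B)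
    (isSelfAdjoint_realImagParts A) (fun c hc => ?_) (fun n X hX h => ?_) ?_ (fun f hf i => ?_)
  · have h := hbd.eq_zero (c := fun k => (c (.inl k) : ℂ) - Complex.I * c (.inr k))
      fun t ht => by
        have h1 := (sub_I_smul_mem_freeSpectrahedron_iff (A := A)
          (X := fun k => ((t : ℂ) * (c k : ℂ)) • (1 : Matrix (Fin 1) (Fin 1) ℂ))
          (fun k => by
            rw [Matrix.IsHermitian, Matrix.conjTranspose_smul, Matrix.conjTranspose_one]
            simp)).mpr (isPositive_blockOp_one_sub_sum_smul hc ht)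
        convert h1 using 2 with k
        rw [smul_smul, ← sub_smul]
        congr 1
        ring
    ext (k | k)
    · simpa using congrArg Complex.re (congrFun h k)
    · simpa using congrArg Complex.im (congrFun h k)
  · exact (sub_I_smul_mem_freeSpectrahedron_iff hX).mp
      (hAB n ((sub_I_smul_mem_freeSpectrahedron_iff hX).mpr h))
  · have hmem : ∀ k, realImagParts A k ∈
        Submodule.span ℂ (insert 1 (Set.range (realImagParts A))) :=
      fun k => Submodule.subset_span (Or.inr ⟨k, rfl⟩)
    refine Submodule.span_le.mpr ?_
    rintro T ((hT | ⟨i, rfl⟩) | ⟨i, rfl⟩)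
    · exact Submodule.subset_span (Or.inl hT)
    · rw [eq_realImagParts A i]
      exact add_mem (hmem _) (Submodule.smul_mem _ _ (hmem _))
    · change star (A i) ∈ Submodule.span ℂ (insert 1 (Set.range (realImagParts A)))
      rw [star_eq_realImagParts A i]
      exact sub_mem (hmem _) (Submodule.smul_mem _ _ (hmem _))
  · rw [star_eq_realImagParts A i, star_eq_realImagParts B i]
    constructor
    · rw [eq_realImagParts A i, eq_realImagParts B i, map_add, map_smul, hf, hf]
    · rw [map_sub, map_smul, hf, hf]

end Spectrahedra

/-! ### The main theorem. -/

theorem theorem4p11 {H K : Type*}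
    [NormedAddCommGroup H] [InnerProductSpace ℂ H] [CompleteSpace H]
    [NormedAddCommGroup K] [InnerProductSpace ℂ K] [CompleteSpace K]
    {d : ℕ} (hd : 1 ≤ d) (A : Fin d → H →L[ℂ] H) (B : Fin d → K →L[ℂ] K) :
    ((freeSpectrahedron A).IsBounded →
      (∀ n : ℕ, (∃ φ : operatorSystem A →ₗ[ℂ] operatorSystem B,
          IsUnitalInterpolating A B φ ∧ IsNPositive n φ) →
        freeSpectrahedron A n ⊆ freeSpectrahedron B n) ∧
      ((∃ φ : operatorSystem A →ₗ[ℂ] operatorSystem B,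
          IsUnitalInterpolating A B φ ∧ IsCompletelyPositive φ) ↔
        ∀ n : ℕ, freeSpectrahedron A n ⊆ freeSpectrahedron B n) ∧
      ((∃ φ : operatorSystem A →ₗ[ℂ] operatorSystem B,
          IsUnitalInterpolating A B φ ∧ IsCompletelyIsometric φ) ↔
        freeSpectrahedron A = freeSpectrahedron B)) ∧
    ((∀ i, IsSelfAdjoint (A i)) → (∀ i, IsSelfAdjoint (B i)) →
      (saFreeSpectrahedron A).IsBounded →
      (∀ n : ℕ, (∃ φ : operatorSystem A →ₗ[ℂ] operatorSystem B,
          IsUnitalInterpolating A B φ ∧ IsNPositive n φ) →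
        saFreeSpectrahedron A n ⊆ saFreeSpectrahedron B n) ∧
      ((∃ φ : operatorSystem A →ₗ[ℂ] operatorSystem B,
          IsUnitalInterpolating A B φ ∧ IsCompletelyPositive φ) ↔
        ∀ n : ℕ, saFreeSpectrahedron A n ⊆ saFreeSpectrahedron B n) ∧
      ((∃ φ : operatorSystem A →ₗ[ℂ] operatorSystem B,
          IsUnitalInterpolating A B φ ∧ IsCompletelyIsometric φ) ↔
        saFreeSpectrahedron A = saFreeSpectrahedron B)) := by
  refine ⟨fun hbd => ⟨?_, ⟨?_, ?_⟩, ?_, ?_⟩, fun hA hB hbd => ⟨?_, ⟨?_, ?_⟩, ?_, ?_⟩⟩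
  · rintro n ⟨φ, hφ, hpos⟩
    exact hpos.freeSpectrahedron_subset hφ
  · rintro ⟨φ, hφ, hpos⟩ n
    exact (hpos n).freeSpectrahedron_subset hφ
  · exact exists_isCompletelyPositive_of_freeSpectrahedron_subset hd hbd
  · rintro ⟨φ, hφ, hiso⟩
    obtain ⟨ψ, hψ, hψpos⟩ := hiso.exists_inverse hφ
    exact funext fun n => Set.Subset.antisymm
      ((hiso.isCompletelyPositive hφ.map_one n).freeSpectrahedron_subset hφ)
      ((hψpos n).freeSpectrahedron_subset hψ)
  · intro h
    obtain ⟨φ, hφ, hφpos⟩ := exists_isCompletelyPositive_of_freeSpectrahedron_subset hd hbd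
      fun n => (congrFun h n).subset
    -- Equality of the sets transfers boundedness to the spectrahedron of `B`, so the reverse map
    -- exists too.
    obtain ⟨ψ, hψ, hψpos⟩ := exists_isCompletelyPositive_of_freeSpectrahedron_subset hd (h ▸ hbd)
      fun n => (congrFun h n).superset
    exact ⟨φ, hφ, isCompletelyIsometric_of_inverse hφ hφpos hψ hψpos⟩
  · rintro n ⟨φ, hφ, hpos⟩
    exact hpos.saFreeSpectrahedron_subset hφ
  · rintro ⟨φ, hφ, hpos⟩ n
    exact (hpos n).saFreeSpectrahedron_subset hφ
  · exact exists_isCompletelyPositive_of_saFreeSpectrahedron_subset hd hA hB hbd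
  · rintro ⟨φ, hφ, hiso⟩
    obtain ⟨ψ, hψ, hψpos⟩ := hiso.exists_inverse hφ
    exact funext fun n => Set.Subset.antisymm
      ((hiso.isCompletelyPositive hφ.map_one n).saFreeSpectrahedron_subset hφ)
      ((hψpos n).saFreeSpectrahedron_subset hψ)
  · intro h
    obtain ⟨φ, hφ, hφpos⟩ := exists_isCompletelyPositive_of_saFreeSpectrahedron_subset hd hA hB
      hbd fun n => (congrFun h n).subset
    obtain ⟨ψ, hψ, hψpos⟩ := exists_isCompletelyPositive_of_saFreeSpectrahedron_subset hd hB hA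
      (h ▸ hbd) fun n => (congrFun h n).superset
    exact ⟨φ, hφ, isCompletelyIsometric_of_inverse hφ hφpos hψ hψpos⟩
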